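/- There exist absolute constants $c_0,c_1,c_2>0$ for which the following holds. Let $M,N$ be non-negative integers with $N\ge c_0M$, let $x\ge 1$, and let $X$ be the standard Gaussian vector in $\mathbb R^M$. There is a square-integrable, mean-zero, variance-one random variable $\zeta$, independent of $X$ (whose law may depend on $M,N,x$), such that for every $t^*\in\mathbb R^M$ the following is true. Set $Y=\langle X,t^*\rangle+\zeta$, let $R(t)=\mathbb E\,(Y-\langle X,t\rangle)^2$ be the squared risk of $t\in\mathbb R^M$, and let $(X_i,Y_i)_{i=1}^N$ be independent copies of $(X,Y)$. Then $R(t)$ is finite and $\|t-t^*\|_2^2=R(t)-R(t^*)$ for every $t\in\mathbb R^M$, and, with probability at least $c_1/x$, empirical risk minimizers $$\hat t\in\operatorname*{argmin}_{t\in\mathbb R^M}\sum_{i=1}^N\big(Y_i-\langle X_i,t\rangle\big)^2$$ exist and every such $\hat t$ satisfies $$\|\hat t-t^*\|_2^2=R(\hat t)-R(t^*)\ \ge\ \frac{c_2\,x\,M}{N}$$ (for $M=N=0$ the right-hand side is read as $0$). Consequently, an exponential probability bound for empirical risk minimization is impossible when only the second moment of the noise is controlled: for every $M\ge1$, every $t^*\in\mathbb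 R^M$, all constants $C,K,b>0$ and every real sequence $\varepsilon_N\to0$, it is not true that for every $x\ge1$ and all sufficiently large $N$ (depending on $x$), for every mean-zero, variance-one noise $\zeta$ independent of $X$, with probability at least $1-\varepsilon_N-Ke^{-bx}$ some empirical risk minimizer $\hat t$ satisfies $\|\hat t-t^*\|_2^2\le CxM/N$. -/

import Mathlib

open MeasureTheory ProbabilityTheory Filter Topology

namespace GaussianLinearModel

/-- `ν` is the law of a square-integrable real random variable with mean zero and variance one. -/
structure IsStandardizedNoise (ν : Measure ℝ) : Prop where
  isProbabilityMeasure : IsProbabilityMeasure ν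
  memLp_two : MemLp (fun z : ℝ => z) 2 ν
  mean_eq_zero : ∫ z, z ∂ν = 0
  variance_eq_one : Var[fun z : ℝ => z; ν] = 1

/-- The joint law of `(X, Y)` where `Y = ⟨X, tstar⟩ + ζ`, `X` is the standard Gaussian vector of
`ℝ^M`, `ζ` has law `ν`, and `X` and `ζ` are independent (so `(X, ζ)` has the product law). -/
noncomputable def modelLaw {M : ℕ} (tstar : EuclideanSpace ℝ (Fin M)) (ν : Measure ℝ) :
    Measure (EuclideanSpace ℝ (Fin M) × ℝ) :=
  ((stdGaussian (EuclideanSpace ℝ (Fin M))).prod ν).map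
    (fun p => (p.1, inner ℝ p.1 tstar + p.2))

/-- The law of the sample `(X_i, Y_i)`, `i = 1, …, N`, of independent copies of `(X, Y)`. -/
noncomputable def sampleLaw {M : ℕ} (N : ℕ) (tstar : EuclideanSpace ℝ (Fin M)) (ν : Measure ℝ) :
    Measure (Fin N → EuclideanSpace ℝ (Fin M) × ℝ) :=
  Measure.pi (fun _ => modelLaw tstar ν)

/-- The squared loss `(y - ⟨x, t⟩)^2`. -/
noncomputable def loss {M : ℕ} (t : EuclideanSpace ℝ (Fin M))
    (p : EuclideanSpace ℝ (Fin M) × ℝ) : ℝ :=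
  (p.2 - inner ℝ p.1 t) ^ 2

/-- The squared risk `R(t) = E (Y - ⟨X, t⟩)^2`. -/
noncomputable def risk {M : ℕ} (tstar : EuclideanSpace ℝ (Fin M)) (ν : Measure ℝ)
    (t : EuclideanSpace ℝ (Fin M)) : ℝ :=
  ∫ p, loss t p ∂(modelLaw tstar ν)

/-- The set `argmin_t ∑ i, (Y_i - ⟨X_i, t⟩)^2` of empirical risk minimizers for the sample `S`. -/
def ermSet {M N : ℕ} (S : Fin N → EuclideanSpace ℝ (Fin M) × ℝ) :
    Set (EuclideanSpace ℝ (Fin M)) :=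
  {t | ∀ s : EuclideanSpace ℝ (Fin M), ∑ i, loss t (S i) ≤ ∑ i, loss s (S i)}

end GaussianLinearModel

namespace GaussianLinearModel

/-! Take noise that is zero except with probability `p = 1 / (2xN)`, when it is `±1/√p`. With
probability of order `Np`, i.e. `1/x`, exactly one sample point `j` carries noise, with `z² = 2xN`.
The normal equations then read `A h = z X_j`, with `h` the error and `A = ∑ X_i X_iᵀ`. No spectral
bound on `A` is needed: Cauchy–Schwarz gives `z² ‖X_j‖⁶ ≤ ‖h‖² Q²`, where `Q = ⟨A X_j, X_j⟩`
(`noise_sq_mul_le_of_mem_ermSet`). Markov bounds give `‖X_j‖² ≳ M` and `Q ≲ NM` with probability at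
least 1/2 (`half_le_measureReal_typicalDesign`), hence `‖h‖² ≳ xM/N`. The impossibility claim
follows because a failure probability of order `1/x` cannot be dominated by `K exp(-bx)`. -/

variable {M N : ℕ}

/-! ### Least squares: existence, normal equations, deterministic error bound. -/

lemma ermSet_nonempty (S : Fin N → EuclideanSpace ℝ (Fin M) × ℝ) : (ermSet S).Nonempty := by
  let L : EuclideanSpace ℝ (Fin M) →ₗ[ℝ] EuclideanSpace ℝ (Fin N) :=
    { toFun := fun t => WithLp.toLp 2 fun i => inner ℝ (S i).1 t
      map_add' := fun s t => by ext i; simp [inner_add_right]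
      map_smul' := fun c t => by ext i; simp [inner_smul_right] }
  let y : EuclideanSpace ℝ (Fin N) := WithLp.toLp 2 fun i => (S i).2
  have hloss : ∀ t, ∑ i, loss t (S i) = ‖y - L t‖ ^ 2 := fun t => by
    simp [EuclideanSpace.real_norm_sq_eq, loss, y, L]
  -- Any preimage of the orthogonal projection of `y` onto the range of `L` is a minimizer; no rank
  -- condition is needed.
  obtain ⟨t, ht⟩ := (Submodule.starProjection_apply_mem (LinearMap.range L) y)
  refine ⟨t, fun s => ?_⟩
  rw [hloss, hloss, ht, Submodule.starProjection_minimal]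
  refine pow_le_pow_left₀ (Real.iInf_nonneg fun _ => norm_nonneg _) ?_ 2
  exact ciInf_le ⟨0, by rintro _ ⟨w, rfl⟩; exact norm_nonneg _⟩
    (⟨L s, LinearMap.mem_range_self L s⟩ : LinearMap.range L)

lemma eq_zero_of_forall_mul_le_mul_sq {a b : ℝ} (ha : 0 ≤ a) (h : ∀ s : ℝ, 2 * s * b ≤ s ^ 2 * a) :
    b = 0 := by
  -- Near the optimal `s = b / a`; the `+ 1` covers `a = 0`.
  have h1 := h (b / (a + 1))
  have ha' : 0 < a + 1 := by linarith
  have h2 : 2 * b ^ 2 * (a + 1) ≤ b ^ 2 * a := by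
    have := mul_le_mul_of_nonneg_right h1 (sq_nonneg (a + 1))
    field_simp at this
    nlinarith
  nlinarith [mul_nonneg (sq_nonneg b) ha]

/-- The normal equations of the least squares problem. -/
lemma sum_residual_mul_inner_eq_zero {S : Fin N → EuclideanSpace ℝ (Fin M) × ℝ}
    {t : EuclideanSpace ℝ (Fin M)} (ht : t ∈ ermSet S) (v : EuclideanSpace ℝ (Fin M)) :
    ∑ i, ((S i).2 - inner ℝ (S i).1 t) * inner ℝ (S i).1 v = 0 := by
  refine eq_zero_of_forall_mul_le_mul_sq (a := ∑ i, (inner ℝ (S i).1 v) ^ 2)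
    (Finset.sum_nonneg fun _ _ => sq_nonneg _) fun s => ?_
  have h := ht (t + s • v)
  have h2 : ∑ i, loss (t + s • v) (S i) = ∑ i, loss t (S i) -
      2 * s * ∑ i, ((S i).2 - inner ℝ (S i).1 t) * inner ℝ (S i).1 v +
      s ^ 2 * ∑ i, (inner ℝ (S i).1 v) ^ 2 := by
    simp only [Finset.mul_sum, ← Finset.sum_sub_distrib, ← Finset.sum_add_distrib, loss,
      inner_add_right, inner_smul_right]
    exact Finset.sum_congr rfl fun i _ => by ring
  linarith

/-- If all noise terms but the `j`-th vanish, the error of every empirical risk minimizer is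
bounded below in terms of the `j`-th design vector and its correlations with the others. -/
lemma noise_sq_mul_le_of_mem_ermSet {S : Fin N → EuclideanSpace ℝ (Fin M) × ℝ}
    {t tstar : EuclideanSpace ℝ (Fin M)} (ht : t ∈ ermSet S) (j : Fin N)
    (hj : ∀ i, i ≠ j → (S i).2 - inner ℝ (S i).1 tstar = 0)
    (hz : (S j).2 - inner ℝ (S j).1 tstar ≠ 0) :
    ((S j).2 - inner ℝ (S j).1 tstar) ^ 2 * (‖(S j).1‖ ^ 2) ^ 3 ≤
      ‖t - tstar‖ ^ 2 * (∑ i, (inner ℝ (S i).1 (S j).1) ^ 2) ^ 2 := by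
  set z := (S j).2 - inner ℝ (S j).1 tstar
  set h := t - tstar
  set Q := ∑ i, (inner ℝ (S i).1 (S j).1) ^ 2
  have normal : ∀ v, ∑ i, inner ℝ (S i).1 h * inner ℝ (S i).1 v = z * inner ℝ (S j).1 v := by
    intro v
    have h1 := sum_residual_mul_inner_eq_zero ht v
    have h2 : ∑ i, ((S i).2 - inner ℝ (S i).1 tstar) * inner ℝ (S i).1 v
        = z * inner ℝ (S j).1 v :=
      Finset.sum_eq_single j (fun i _ hij => by rw [hj i hij, zero_mul])
        (fun hh => absurd (Finset.mem_univ j) hh)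
    rw [← h2, ← sub_eq_zero, ← neg_eq_zero, ← h1, ← Finset.sum_sub_distrib,
      ← Finset.sum_neg_distrib]
    refine Finset.sum_congr rfl fun i _ => ?_
    simp only [h, inner_sub_right]
    ring
  -- With `a = ‖X_j‖²`, testing against `h` and `X_j` and applying Cauchy–Schwarz gives `(z a)² ≤ z
  -- ⟨X_j, h⟩ Q`. Squaring it and using `⟨X_j, h⟩² ≤ a ‖h‖²` leaves a common factor `z² a` to
  -- cancel.
  have e1 := normal h
  have e2 := normal (S j).1
  have cs := Finset.sum_mul_sq_le_sq_mul_sq Finset.univ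
    (fun i => inner ℝ (S i).1 h) (fun i => inner ℝ (S i).1 (S j).1)
  simp only [← sq] at e1
  rw [e2, e1, real_inner_self_eq_norm_sq] at cs
  change _ ≤ _ * Q at cs
  have hin : (inner ℝ (S j).1 h) ^ 2 ≤ ‖(S j).1‖ ^ 2 * ‖h‖ ^ 2 := by
    rw [← mul_pow, ← sq_abs]
    exact pow_le_pow_left₀ (abs_nonneg _) (abs_real_inner_le_norm _ _) 2
  set a := ‖(S j).1‖ ^ 2
  have ha : 0 ≤ a := sq_nonneg _
  have h3 : (z ^ 2 * a) * (z ^ 2 * a ^ 3) ≤ (z ^ 2 * a) * (‖h‖ ^ 2 * Q ^ 2) := by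
    have h4 : ((z * a) ^ 2) ^ 2 ≤ (z * inner ℝ (S j).1 h * Q) ^ 2 :=
      pow_le_pow_left₀ (sq_nonneg _) cs 2
    have h5 := mul_le_mul_of_nonneg_left hin (mul_nonneg (sq_nonneg z) (sq_nonneg Q))
    nlinarith
  rcases ha.eq_or_lt with ha0 | ha0
  · rw [← ha0]
    simpa using mul_nonneg (sq_nonneg ‖h‖) (sq_nonneg Q)
  · exact le_of_mul_le_mul_left h3 (by positivity)

/-! ### The model law -/

instance isProbabilityMeasure_modelLaw (tstar : EuclideanSpace ℝ (Fin M)) (ν : Measure ℝ)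
    [IsProbabilityMeasure ν] : IsProbabilityMeasure (modelLaw tstar ν) :=
  Measure.isProbabilityMeasure_map (Measurable.aemeasurable (by fun_prop))

instance isProbabilityMeasure_sampleLaw (tstar : EuclideanSpace ℝ (Fin M)) (ν : Measure ℝ)
    [IsProbabilityMeasure ν] : IsProbabilityMeasure (sampleLaw N tstar ν) := by
  unfold sampleLaw; infer_instance

lemma integrable_inner_sq (v : EuclideanSpace ℝ (Fin M)) :
    Integrable (fun x => (inner ℝ x v) ^ 2) (stdGaussian (EuclideanSpace ℝ (Fin M))) :=
  (IsGaussian.memLp_two_id.inner_const (𝕜 := ℝ) v).integrable_sq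

lemma integral_inner_stdGaussian (v : EuclideanSpace ℝ (Fin M)) :
    ∫ x, inner ℝ x v ∂stdGaussian (EuclideanSpace ℝ (Fin M)) = 0 := by
  simpa [real_inner_comm] using integral_strongDual_stdGaussian (innerSL ℝ v)

lemma integral_inner_sq_stdGaussian (v : EuclideanSpace ℝ (Fin M)) :
    ∫ x, (inner ℝ x v) ^ 2 ∂stdGaussian (EuclideanSpace ℝ (Fin M)) = ‖v‖ ^ 2 := by
  have h := variance_dual_stdGaussian (innerSL ℝ v)
  rw [variance_eq_integral (by fun_prop), integral_strongDual_stdGaussian,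
    innerSL_apply_norm] at h
  simpa [real_inner_comm] using h

lemma integrable_norm_sq_stdGaussian :
    Integrable (fun x => ‖x‖ ^ 2) (stdGaussian (EuclideanSpace ℝ (Fin M))) :=
  IsGaussian.memLp_two_id.integrable_norm_pow (by norm_num)

lemma integral_norm_sq_stdGaussian :
    ∫ x, ‖x‖ ^ 2 ∂stdGaussian (EuclideanSpace ℝ (Fin M)) = M := by
  have h : ∀ x : EuclideanSpace ℝ (Fin M),
      ‖x‖ ^ 2 = ∑ i, (inner ℝ x (EuclideanSpace.basisFun (Fin M) ℝ i)) ^ 2 := fun x => by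
    rw [OrthonormalBasis.sum_sq_inner_left]
  simp_rw [h]
  rw [integral_finsetSum _ fun i _ => integrable_inner_sq _]
  simp [integral_inner_sq_stdGaussian]

/-- The cross term factorizes by independence and vanishes because both factors are centred; the `1`
is the noise variance. -/
lemma integrable_loss_and_risk_eq {ν : Measure ℝ} (hν : IsStandardizedNoise ν)
    (tstar t : EuclideanSpace ℝ (Fin M)) :
    Integrable (loss t) (modelLaw tstar ν) ∧ risk tstar ν t = ‖t - tstar‖ ^ 2 + 1 := by
  have := hν.isProbabilityMeasure
  let φ : EuclideanSpace ℝ (Fin M) × ℝ → EuclideanSpace ℝ (Fin M) × ℝ :=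
    fun p => (p.1, inner ℝ p.1 tstar + p.2)
  have hφ : MeasurePreserving φ ((stdGaussian (EuclideanSpace ℝ (Fin M))).prod ν)
      (modelLaw tstar ν) := ⟨by fun_prop, rfl⟩
  have hl : Measurable (loss t) := by unfold loss; fun_prop
  have hz2 : ∫ z, z ^ 2 ∂ν = 1 := by
    have := hν.variance_eq_one
    rw [variance_eq_integral (by fun_prop), hν.mean_eq_zero] at this
    simpa using this
  have hcomp : loss t ∘ φ =
      fun p => (inner ℝ p.1 (t - tstar)) ^ 2 + p.2 ^ 2 - 2 * (inner ℝ p.1 (t - tstar) * p.2) := by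
    funext p
    simp only [Function.comp_apply, φ, loss, inner_sub_right]
    ring
  have i1 : Integrable (fun p : EuclideanSpace ℝ (Fin M) × ℝ => (inner ℝ p.1 (t - tstar)) ^ 2)
      ((stdGaussian _).prod ν) := (integrable_inner_sq (t - tstar)).comp_fst ν
  have i2 : Integrable (fun p : EuclideanSpace ℝ (Fin M) × ℝ => p.2 ^ 2)
      ((stdGaussian _).prod ν) := hν.memLp_two.integrable_sq.comp_snd _
  have i4 : Integrable (fun x => inner ℝ x (t - tstar))
      (stdGaussian (EuclideanSpace ℝ (Fin M))) :=
    (IsGaussian.memLp_two_id.inner_const (𝕜 := ℝ) (t - tstar)).integrable (by norm_num)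
  have i5 : Integrable (fun z : ℝ => z) ν := hν.memLp_two.integrable (by norm_num)
  have i3 : Integrable (fun p : EuclideanSpace ℝ (Fin M) × ℝ => inner ℝ p.1 (t - tstar) * p.2)
      ((stdGaussian _).prod ν) := i4.mul_prod i5
  constructor
  · rw [← hφ.integrable_comp hl.aestronglyMeasurable, hcomp]
    exact (i1.add i2).sub (i3.const_mul 2)
  · rw [risk, ← hφ.map_eq, integral_map hφ.measurable.aemeasurable hl.aestronglyMeasurable]
    change ∫ p, (loss t ∘ φ) p ∂_ = _
    rw [hcomp]
    have i12 := i1.add i2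
    simp only [Pi.add_def] at i12
    rw [integral_sub i12 (i3.const_mul 2), integral_add i1 i2, integral_const_mul,
      integral_prod_mul (fun x => inner ℝ x (t - tstar)) (fun z : ℝ => z),
      integral_fun_fst (fun x => (inner ℝ x (t - tstar)) ^ 2), integral_fun_snd (fun z : ℝ => z ^ 2),
      integral_inner_stdGaussian, integral_inner_sq_stdGaussian, hz2]
    simp

/-- The sample of a design and a noise vector, recovered from the sample of pairs `(X_i, Y_i)`. -/
lemma measurePreserving_design_noise (tstar : EuclideanSpace ℝ (Fin M)) (ν : Measure ℝ)
    [IsProbabilityMeasure ν] :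
    MeasurePreserving (fun S : Fin N → EuclideanSpace ℝ (Fin M) × ℝ =>
        (fun i => (S i).1, fun i => (S i).2 - inner ℝ (S i).1 tstar))
      (sampleLaw N tstar ν)
      ((Measure.pi fun _ => stdGaussian (EuclideanSpace ℝ (Fin M))).prod
        (Measure.pi fun _ => ν)) := by
  let ψ : EuclideanSpace ℝ (Fin M) × ℝ → EuclideanSpace ℝ (Fin M) × ℝ :=
    fun p => (p.1, p.2 - inner ℝ p.1 tstar)
  have hψ : MeasurePreserving ψ (modelLaw tstar ν)
      ((stdGaussian (EuclideanSpace ℝ (Fin M))).prod ν) := by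
    refine ⟨by fun_prop, ?_⟩
    rw [modelLaw, Measure.map_map (by fun_prop) (by fun_prop)]
    convert Measure.map_id
    ext p <;> simp [ψ]
  have h1 := measurePreserving_pi (fun _ : Fin N => modelLaw tstar ν)
    (fun _ : Fin N => (stdGaussian (EuclideanSpace ℝ (Fin M))).prod ν) (fun _ => hψ)
  exact (measurePreserving_arrowProdEquivProdArrow _ _ (Fin N) _ _).comp h1

/-! ### Norms and correlations of the Gaussian design. -/

lemma gaussianReal_real_Ioo_le : (gaussianReal 0 1).real (Set.Ioo (-(1 / 8)) (1 / 8)) ≤ 1 / 8 := by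
  have hpdf : ∀ x, gaussianPDF 0 1 x ≤ ENNReal.ofReal (1 / 2) := fun x => by
    refine ENNReal.ofReal_le_ofReal ?_
    rw [gaussianPDFReal]
    have h2 : (2 : ℝ) ≤ √(2 * Real.pi * ((1 : NNReal) : ℝ)) :=
      Real.le_sqrt_of_sq_le (by simp; nlinarith [Real.pi_gt_three])
    have h3 : Real.exp (-(x - 0) ^ 2 / (2 * ((1 : NNReal) : ℝ))) ≤ 1 :=
      Real.exp_le_one_iff.2 (div_nonpos_of_nonpos_of_nonneg (by nlinarith [sq_nonneg (x - 0)])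
        (by norm_num))
    calc _ ≤ (2 : ℝ)⁻¹ * 1 := mul_le_mul (inv_anti₀ (by norm_num) h2) h3 (Real.exp_nonneg _)
          (by norm_num)
      _ = 1 / 2 := by norm_num
  refine ENNReal.toReal_le_of_le_ofReal (by norm_num) ?_
  rw [gaussianReal_apply _ one_ne_zero]
  calc _ ≤ ∫⁻ _ in Set.Ioo (-(1 / 8) : ℝ) (1 / 8), ENNReal.ofReal (1 / 2) :=
        lintegral_mono fun x => hpdf x
    _ = ENNReal.ofReal (1 / 8) := by
        rw [setLIntegral_const, Real.volume_Ioo, ← ENNReal.ofReal_mul (by norm_num)]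
        norm_num

lemma stdGaussian_real_abs_coord_lt_le (k : Fin M) :
    (stdGaussian (EuclideanSpace ℝ (Fin M))).real {x | |x k| < 1 / 8} ≤ 1 / 8 := by
  have hm : MeasurePreserving (fun x : EuclideanSpace ℝ (Fin M) => x k)
      (stdGaussian (EuclideanSpace ℝ (Fin M))) (gaussianReal 0 1) := by
    refine ⟨by fun_prop, ?_⟩
    rw [← map_pi_eq_stdGaussian, Measure.map_map (by fun_prop) (by fun_prop)]
    exact (measurePreserving_eval (fun _ : Fin M => gaussianReal 0 1) k).map_eq
  have h := hm.measureReal_preimage (s := Set.Ioo (-(1 / 8)) (1 / 8))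
    measurableSet_Ioo.nullMeasurableSet
  refine le_of_eq_of_le ?_ gaussianReal_real_Ioo_le
  rw [← h]
  congr 1
  ext x
  simp [abs_lt]

/-- The expected number of coordinates below 1/8 in modulus is at most `M/8`, so by Markov at least
`M/2` are small with probability at most 1/4. Otherwise more than `M/2` coordinates contribute at
least 1/64 each. -/
lemma stdGaussian_real_norm_sq_lt_le (hM : 1 ≤ M) :
    (stdGaussian (EuclideanSpace ℝ (Fin M))).real {x | ‖x‖ ^ 2 < M / 128} ≤ 1 / 4 := by
  have hM' : (1 : ℝ) ≤ M := by exact_mod_cast hM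
  let s : Fin M → Set (EuclideanSpace ℝ (Fin M)) := fun k => {x | |x k| < 1 / 8}
  have hs : ∀ k, MeasurableSet (s k) := fun k =>
    measurableSet_lt (by fun_prop) measurable_const
  let f : EuclideanSpace ℝ (Fin M) → ℝ := fun x => ∑ k, (s k).indicator 1 x
  have hfi : ∀ k ∈ Finset.univ, Integrable ((s k).indicator (1 : EuclideanSpace ℝ (Fin M) → ℝ))
      (stdGaussian (EuclideanSpace ℝ (Fin M))) := fun k _ =>
    (integrable_const (1 : ℝ)).indicator (hs k)
  have hint : ∫ x, f x ∂stdGaussian (EuclideanSpace ℝ (Fin M)) ≤ M / 8 := by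
    rw [integral_finsetSum _ hfi]
    simp_rw [integral_indicator_one (hs _)]
    refine (Finset.sum_le_sum fun k _ => stdGaussian_real_abs_coord_lt_le k).trans (le_of_eq ?_)
    simp
    ring
  have hmk := mul_meas_ge_le_integral_of_nonneg (μ := stdGaussian (EuclideanSpace ℝ (Fin M)))
    (f := f) (ae_of_all _ fun x => Finset.sum_nonneg fun k _ =>
      Set.indicator_nonneg (fun _ _ => zero_le_one) x) (integrable_finsetSum _ hfi) (M / 2)
  have hsub : {x : EuclideanSpace ℝ (Fin M) | ‖x‖ ^ 2 < M / 128} ⊆ {x | (M : ℝ) / 2 ≤ f x} := by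
    intro x hx
    have h1 : ∑ k, (1 - 64 * x k ^ 2) ≤ f x := by
      refine Finset.sum_le_sum fun k _ => ?_
      by_cases hk : x ∈ s k
      · simp only [Set.indicator_of_mem hk, Pi.one_apply]
        nlinarith [sq_nonneg (x k)]
      · simp only [Set.indicator_of_notMem hk]
        have hk' : 1 / 8 ≤ |x k| := not_lt.1 hk
        have := pow_le_pow_left₀ (by norm_num) hk' 2
        rw [sq_abs] at this
        linarith
    rw [Finset.sum_sub_distrib, ← Finset.mul_sum, ← EuclideanSpace.real_norm_sq_eq] at h1
    simp only [Set.mem_ofPred_eq] at hx ⊢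
    simp at h1
    linarith
  have := measureReal_mono (μ := stdGaussian (EuclideanSpace ℝ (Fin M))) hsub
  nlinarith

lemma integrable_inner_sq_prod : Integrable
    (fun p : EuclideanSpace ℝ (Fin M) × EuclideanSpace ℝ (Fin M) => (inner ℝ p.1 p.2) ^ 2)
    ((stdGaussian _).prod (stdGaussian _)) := by
  refine (integrable_norm_sq_stdGaussian.mul_prod integrable_norm_sq_stdGaussian).mono'
    (Measurable.aestronglyMeasurable (by fun_prop)) (ae_of_all _ fun p => ?_)
  rw [Real.norm_of_nonneg (sq_nonneg _), ← mul_pow, ← sq_abs]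
  exact pow_le_pow_left₀ (abs_nonneg _) (abs_real_inner_le_norm _ _) 2

lemma integral_inner_sq_prod :
    ∫ p : EuclideanSpace ℝ (Fin M) × EuclideanSpace ℝ (Fin M), (inner ℝ p.1 p.2) ^ 2
      ∂((stdGaussian _).prod (stdGaussian _)) = M := by
  rw [integral_prod _ integrable_inner_sq_prod]
  have h : ∀ x : EuclideanSpace ℝ (Fin M),
      ∫ y, (inner ℝ x y) ^ 2 ∂stdGaussian (EuclideanSpace ℝ (Fin M)) = ‖x‖ ^ 2 := fun x => by
    rw [← integral_inner_sq_stdGaussian x]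
    simp_rw [real_inner_comm]
  simp_rw [h]
  exact integral_norm_sq_stdGaussian

lemma measurePreserving_eval_pair {Ω : Type*} [MeasurableSpace Ω] (μ : Measure Ω)
    [IsProbabilityMeasure μ] {i j : Fin N} (hij : i ≠ j) :
    MeasurePreserving (fun X : Fin N → Ω => (X i, X j)) (Measure.pi fun _ => μ) (μ.prod μ) := by
  refine ⟨by fun_prop, ?_⟩
  have h := (iIndepFun_pi (μ := fun _ : Fin N => μ) (X := fun _ => id)
    (fun _ => aemeasurable_id)).indepFun hij
  rw [indepFun_iff_map_prod_eq_prod_map_map (Measurable.aemeasurable (by fun_prop))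
    (Measurable.aemeasurable (by fun_prop))] at h
  simp only [id] at h
  rw [h]
  congr 1
  · exact (measurePreserving_eval (fun _ : Fin N => μ) i).map_eq
  · exact (measurePreserving_eval (fun _ : Fin N => μ) j).map_eq

/-- The designs whose `j`-th vector has typical length and typical correlations with the others. -/
def typicalDesign (M N : ℕ) (j : Fin N) : Set (Fin N → EuclideanSpace ℝ (Fin M)) :=
  {X | (M : ℝ) / 128 ≤ ‖X j‖ ^ 2 ∧ ‖X j‖ ^ 2 ≤ 8 * M ∧
    ∑ i ∈ Finset.univ.erase j, (inner ℝ (X i) (X j)) ^ 2 ≤ 8 * N * M}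

lemma measurableSet_typicalDesign (j : Fin N) : MeasurableSet (typicalDesign M N j) := by
  unfold typicalDesign
  measurability

lemma half_le_measureReal_typicalDesign (hM : 1 ≤ M) (j : Fin N) :
    1 / 2 ≤ (Measure.pi fun _ : Fin N => stdGaussian (EuclideanSpace ℝ (Fin M))).real
      (typicalDesign M N j) := by
  set γ := stdGaussian (EuclideanSpace ℝ (Fin M))
  set P := Measure.pi fun _ : Fin N => γ
  have hM' : (1 : ℝ) ≤ M := by exact_mod_cast hM
  have hN' : (1 : ℝ) ≤ N := by exact_mod_cast j.pos
  have he : MeasurePreserving (fun X : Fin N → EuclideanSpace ℝ (Fin M) => X j) P γ :=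
    measurePreserving_eval (fun _ : Fin N => γ) j
  have b1 : P.real {X | ‖X j‖ ^ 2 < M / 128} ≤ 1 / 4 := by
    have h := he.measureReal_preimage (s := {x | ‖x‖ ^ 2 < (M : ℝ) / 128})
      (measurableSet_lt (by fun_prop) (by fun_prop)).nullMeasurableSet
    exact h.trans_le (stdGaussian_real_norm_sq_lt_le hM)
  have b2 : P.real {X | 8 * M ≤ ‖X j‖ ^ 2} ≤ 1 / 8 := by
    have h1 := mul_meas_ge_le_integral_of_nonneg (μ := P)
      (f := fun X => ‖X j‖ ^ 2) (ae_of_all _ fun X => sq_nonneg _)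
      (he.integrable_comp_of_integrable integrable_norm_sq_stdGaussian) (8 * M)
    have h2 : ∫ X, ‖X j‖ ^ 2 ∂P = M := by
      rw [← integral_norm_sq_stdGaussian]
      change _ = ∫ x, ‖x‖ ^ 2 ∂γ
      rw [← he.map_eq, integral_map he.measurable.aemeasurable (by fun_prop)]
    rw [h2] at h1
    nlinarith
  have b3 : P.real {X | 8 * N * M ≤ ∑ i ∈ Finset.univ.erase j, (inner ℝ (X i) (X j)) ^ 2}
      ≤ 1 / 8 := by
    have hint : ∀ i ∈ Finset.univ.erase j, Integrable (fun X => (inner ℝ (X i) (X j)) ^ 2) P :=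
      fun i hi => (measurePreserving_eval_pair γ
        (Finset.ne_of_mem_erase hi)).integrable_comp_of_integrable integrable_inner_sq_prod
    have h1 := mul_meas_ge_le_integral_of_nonneg (μ := P)
      (f := fun X => ∑ i ∈ Finset.univ.erase j, (inner ℝ (X i) (X j)) ^ 2)
      (ae_of_all _ fun X => Finset.sum_nonneg fun i _ => sq_nonneg _)
      (integrable_finsetSum _ hint) (8 * N * M)
    have h2 : ∫ X, ∑ i ∈ Finset.univ.erase j, (inner ℝ (X i) (X j)) ^ 2 ∂P ≤ N * M := by
      rw [integral_finsetSum _ hint]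
      have h3 : ∀ i ∈ Finset.univ.erase j, ∫ X, (inner ℝ (X i) (X j)) ^ 2 ∂P = M := fun i hi => by
        rw [← integral_inner_sq_prod,
          ← (measurePreserving_eval_pair γ (Finset.ne_of_mem_erase hi)).map_eq,
          integral_map (Measurable.aemeasurable (by fun_prop))
            (Measurable.aestronglyMeasurable (by fun_prop))]
      rw [Finset.sum_congr rfl h3, Finset.sum_const, nsmul_eq_mul]
      gcongr
      exact (Finset.card_le_univ _).trans (by simp)
    have hNM : (0 : ℝ) < N * M := by positivity
    nlinarith
  -- The three failure probabilities add up to 1/4 + 1/8 + 1/8 = 1/2.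
  have hcov : (typicalDesign M N j)ᶜ ⊆ ({X | ‖X j‖ ^ 2 < M / 128} ∪ {X | 8 * M ≤ ‖X j‖ ^ 2}) ∪
      {X | 8 * N * M ≤ ∑ i ∈ Finset.univ.erase j, (inner ℝ (X i) (X j)) ^ 2} := by
    intro X hX
    by_contra hcon
    simp only [Set.mem_union, Set.mem_ofPred_eq, not_or, not_lt, not_le] at hcon
    exact hX ⟨hcon.1.1, hcon.1.2.le, hcon.2.le⟩
  have h1 := measureReal_mono (μ := P) hcov
  have h2 := measureReal_union_le (μ := P)
    ({X | ‖X j‖ ^ 2 < M / 128} ∪ {X | 8 * M ≤ ‖X j‖ ^ 2})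
    {X | 8 * N * M ≤ ∑ i ∈ Finset.univ.erase j, (inner ℝ (X i) (X j)) ^ 2}
  have h3 := measureReal_union_le (μ := P) {X | ‖X j‖ ^ 2 < M / 128} {X | 8 * M ≤ ‖X j‖ ^ 2}
  rw [probReal_compl_eq_one_sub (measurableSet_typicalDesign j)] at h1
  linarith

/-! ### The sparse noise and the single-spike event. -/

/-- The law of the noise equal to `±1 / √p` with probability `p / 2` each, and to `0` otherwise. -/
noncomputable def sparseNoise (p : ℝ) : Measure ℝ :=
  ENNReal.ofReal (1 - p) • Measure.dirac 0 +
    ENNReal.ofReal (p / 2) • (Measure.dirac (√p)⁻¹ + Measure.dirac (-(√p)⁻¹))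

lemma integrable_sparseNoise (p : ℝ) {f : ℝ → ℝ} (hf : Measurable f) :
    Integrable f (sparseNoise p) := by
  have h : ∀ a, Integrable f (Measure.dirac a) := fun a =>
    integrable_dirac' hf.stronglyMeasurable (by simp)
  exact ((h _).smul_measure (by simp)).add_measure
    (((h _).add_measure (h _)).smul_measure (by simp))

lemma integral_sparseNoise {p : ℝ} (hp0 : 0 ≤ p) (hp1 : p ≤ 1) {f : ℝ → ℝ} (hf : Measurable f) :
    ∫ z, f z ∂sparseNoise p =
      (1 - p) * f 0 + p / 2 * (f (√p)⁻¹ + f (-(√p)⁻¹)) := by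
  have h : ∀ a, Integrable f (Measure.dirac a) := fun a =>
    integrable_dirac' hf.stronglyMeasurable (by simp)
  rw [sparseNoise, integral_add_measure ((h _).smul_measure (by simp))
    (((h _).add_measure (h _)).smul_measure (by simp)), integral_smul_measure,
    integral_smul_measure, integral_add_measure (h _) (h _)]
  simp [hp1, div_nonneg hp0 zero_le_two]

lemma isStandardizedNoise_sparseNoise {p : ℝ} (hp0 : 0 < p) (hp1 : p ≤ 1) :
    IsStandardizedNoise (sparseNoise p) := by
  have hmean : ∫ z, z ∂sparseNoise p = 0 := by
    rw [integral_sparseNoise hp0.le hp1 (f := fun z => z) measurable_id]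
    simp
  refine ⟨⟨?_⟩, ?_, hmean, ?_⟩
  · have h2 : ENNReal.ofReal (p / 2) * (1 + 1) = ENNReal.ofReal p := by
      rw [show (1 + 1 : ENNReal) = ENNReal.ofReal 2 by norm_num, ← ENNReal.ofReal_mul (by linarith)]
      congr 1
      ring
    simp only [sparseNoise, Measure.add_apply, Measure.smul_apply, measure_univ, smul_eq_mul, h2,
      mul_one]
    rw [← ENNReal.ofReal_add (by linarith) hp0.le]
    simp
  · exact (memLp_two_iff_integrable_sq (by fun_prop)).2 (integrable_sparseNoise p (by fun_prop))
  · rw [variance_eq_integral (by fun_prop), hmean,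
      integral_sparseNoise hp0.le hp1 (f := fun z => (z - 0) ^ 2) (by fun_prop)]
    have : (√p)⁻¹ ^ 2 = p⁻¹ := by rw [inv_pow, Real.sq_sqrt hp0.le]
    simp only [sub_zero, neg_sq, this]
    field_simp
    ring

lemma one_sub_le_sparseNoise_real_zero {p : ℝ} [IsFiniteMeasure (sparseNoise p)] :
    1 - p ≤ (sparseNoise p).real {0} := by
  refine (ENNReal.ofReal_le_iff_le_toReal (measure_ne_top _ _)).1 ?_
  simp [sparseNoise]

lemma le_sparseNoise_real_sq_eq {p : ℝ} [IsFiniteMeasure (sparseNoise p)] (hp0 : 0 < p) :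
    p ≤ (sparseNoise p).real {z | z ^ 2 = p⁻¹} := by
  refine (ENNReal.ofReal_le_iff_le_toReal (measure_ne_top _ _)).1 ?_
  have hm : MeasurableSet {z : ℝ | z ^ 2 = p⁻¹} := measurableSet_eq_fun (by fun_prop) (by fun_prop)
  have : (√p)⁻¹ ^ 2 = p⁻¹ := by rw [inv_pow, Real.sq_sqrt hp0.le]
  simp only [sparseNoise, Measure.add_apply, Measure.smul_apply, smul_eq_mul,
    Measure.dirac_apply' _ hm]
  rw [Set.indicator_of_mem (show (√p)⁻¹ ∈ {z : ℝ | z ^ 2 = p⁻¹} from this),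
    Set.indicator_of_mem (show -(√p)⁻¹ ∈ {z : ℝ | z ^ 2 = p⁻¹} from (neg_sq _).trans this)]
  refine le_trans (le_of_eq ?_) le_add_self
  rw [Pi.one_apply, Pi.one_apply, show (1 + 1 : ENNReal) = ENNReal.ofReal 2 by norm_num,
    ← ENNReal.ofReal_mul (by linarith)]
  congr 1
  ring

/-- The noise vectors whose only nonzero entry is the `j`-th, of modulus `1 / √p`. -/
def singleSpike (N : ℕ) (p : ℝ) (j : Fin N) : Set (Fin N → ℝ) :=
  Set.univ.pi fun i => if i = j then {z | z ^ 2 = p⁻¹} else {0}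

lemma measurableSet_singleSpike (p : ℝ) (j : Fin N) : MeasurableSet (singleSpike N p j) := by
  refine MeasurableSet.univ_pi fun i => ?_
  split_ifs
  · exact measurableSet_eq_fun (by fun_prop) (by fun_prop)
  · exact measurableSet_singleton 0

lemma sq_eq_of_mem_singleSpike {p : ℝ} {j : Fin N} {ζ : Fin N → ℝ} (h : ζ ∈ singleSpike N p j) :
    ζ j ^ 2 = p⁻¹ := by
  simpa using h j (Set.mem_univ j)

lemma eq_zero_of_mem_singleSpike {p : ℝ} {j : Fin N} {ζ : Fin N → ℝ} (h : ζ ∈ singleSpike N p j)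
    {i : Fin N} (hi : i ≠ j) : ζ i = 0 := by
  simpa [hi] using h i (Set.mem_univ i)

lemma le_measureReal_singleSpike {p : ℝ} (hp0 : 0 < p) (hp1 : p ≤ 1) (hN : N * p ≤ 1 / 2)
    (j : Fin N) :
    p / 2 ≤ (Measure.pi fun _ : Fin N => sparseNoise p).real (singleSpike N p j) := by
  have := (isStandardizedNoise_sparseNoise hp0 hp1).isProbabilityMeasure
  rw [singleSpike, measureReal_def, Measure.pi_pi, ENNReal.toReal_prod,
    ← Finset.mul_prod_erase _ _ (Finset.mem_univ j)]
  have h1 : ∏ i ∈ Finset.univ.erase j,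
      (sparseNoise p (if i = j then {z | z ^ 2 = p⁻¹} else {0})).toReal =
      (sparseNoise p).real {0} ^ (N - 1) := by
    rw [Finset.prod_congr rfl (g := fun _ => (sparseNoise p).real {0})
      (fun i hi => by rw [if_neg (Finset.ne_of_mem_erase hi), measureReal_def]), Finset.prod_const,
      Finset.card_erase_of_mem (Finset.mem_univ j)]
    simp
  rw [h1, if_pos rfl, ← measureReal_def]
  -- Bernoulli: `(1 - p)^(N-1) ≥ 1 - (N-1)p ≥ 1/2`.
  have hbern := one_add_mul_le_pow (a := -p) (by linarith) (N - 1)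
  have hN1 : ((N - 1 : ℕ) : ℝ) ≤ N := by exact_mod_cast Nat.sub_le N 1
  have h2 : (1 - p) ^ (N - 1) ≤ (sparseNoise p).real {0} ^ (N - 1) :=
    pow_le_pow_left₀ (by linarith) one_sub_le_sparseNoise_real_zero _
  have h3 : 1 / 2 ≤ (sparseNoise p).real {0} ^ (N - 1) := by
    refine le_trans ?_ (hbern.trans (by simpa [sub_eq_add_neg] using h2))
    nlinarith
  have h4 := mul_le_mul (le_sparseNoise_real_sq_eq hp0) h3 (by norm_num) measureReal_nonneg
  linarith

/-- Disjointness makes the probabilities add over `j`, which supplies the factor `N` turning `p`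
into order `1/x`. -/
lemma pairwise_disjoint_typicalDesign_prod_singleSpike {p : ℝ} (hp0 : 0 < p) :
    Pairwise (Function.onFun Disjoint
      fun j : Fin N => typicalDesign M N j ×ˢ singleSpike N p j) := by
  intro j k hjk
  refine Set.disjoint_left.2 fun q hj hk => ?_
  have h1 := sq_eq_of_mem_singleSpike hj.2
  rw [eq_zero_of_mem_singleSpike hk.2 hjk] at h1
  have : 0 < p⁻¹ := inv_pos.2 hp0
  norm_num at h1
  exact hp0.ne h1

lemma isStandardizedNoise_sparseNoise_of_one_le (hN : 1 ≤ N) {x : ℝ} (hx : 1 ≤ x) :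
    IsStandardizedNoise (sparseNoise (1 / (2 * x * N))) := by
  have hN' : (1 : ℝ) ≤ N := by exact_mod_cast hN
  exact isStandardizedNoise_sparseNoise (by positivity)
    ((div_le_one (by positivity)).2 (by nlinarith))

/-! ### The bad event and the conclusion. -/

/-- With probability of order `1 / x`, the sample has a single large noise term, at a typical design
vector, and then every empirical risk minimizer is far from `tstar`. -/
lemma exists_measurableSet_subset_error_ge (hM : 1 ≤ M) (hMN : M ≤ N) {x : ℝ} (hx : 1 ≤ x)
    (tstar : EuclideanSpace ℝ (Fin M)) :
    ∃ G : Set (Fin N → EuclideanSpace ℝ (Fin M) × ℝ), MeasurableSet G ∧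
      1 / 8 / x ≤ (sampleLaw N tstar (sparseNoise (1 / (2 * x * N)))).real G ∧
      ∀ S ∈ G, ∀ t ∈ ermSet S,
        1 / (128 ^ 3 * 72 ^ 2) * x * (M : ℝ) / (N : ℝ) ≤ ‖t - tstar‖ ^ 2 := by
  have hM' : (1 : ℝ) ≤ M := by exact_mod_cast hM
  have hMN' : (M : ℝ) ≤ N := by exact_mod_cast hMN
  have hN' : (1 : ℝ) ≤ N := hM'.trans hMN'
  set p : ℝ := 1 / (2 * x * N) with hp
  have hp0 : 0 < p := by positivity
  have hNp : N * p = 1 / (2 * x) := by rw [hp]; field_simp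
  have hNp2 : N * p ≤ 1 / 2 := by
    rw [hNp]
    exact one_div_le_one_div_of_le (by norm_num) (by linarith)
  have hp1 : p ≤ 1 := by nlinarith
  have := (isStandardizedNoise_sparseNoise hp0 hp1).isProbabilityMeasure
  have hmeas : ∀ j : Fin N, MeasurableSet (typicalDesign M N j ×ˢ singleSpike N p j) := fun j =>
    (measurableSet_typicalDesign j).prod (measurableSet_singleSpike p j)
  have hψ := measurePreserving_design_noise (N := N) tstar (sparseNoise p)
  refine ⟨_ ⁻¹' ⋃ j : Fin N, typicalDesign M N j ×ˢ singleSpike N p j,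
    hψ.measurable (MeasurableSet.iUnion hmeas), ?_, ?_⟩
  · rw [hψ.measureReal_preimage (MeasurableSet.iUnion hmeas).nullMeasurableSet,
      measureReal_iUnion_fintype (pairwise_disjoint_typicalDesign_prod_singleSpike hp0) hmeas]
    simp_rw [measureReal_prod_prod]
    calc 1 / 8 / x = ∑ _j : Fin N, 1 / 2 * (p / 2) := by
          rw [Finset.sum_const, Finset.card_univ, Fintype.card_fin, nsmul_eq_mul]
          rw [show (N : ℝ) * (1 / 2 * (p / 2)) = N * p / 4 by ring, hNp]
          field_simp
          norm_num
      _ ≤ _ := Finset.sum_le_sum fun j _ => mul_le_mul (half_le_measureReal_typicalDesign hM j)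
          (le_measureReal_singleSpike hp0 hp1 hNp2 j) (by positivity) measureReal_nonneg
  · intro S hS t ht
    obtain ⟨j, ⟨hlow, hup, hcorr⟩, hspike⟩ := Set.mem_iUnion.1 hS
    have hz : ((S j).2 - inner ℝ (S j).1 tstar) ^ 2 = p⁻¹ := sq_eq_of_mem_singleSpike hspike
    have hz0 : (S j).2 - inner ℝ (S j).1 tstar ≠ 0 := by
      intro h0
      rw [h0] at hz
      have : 0 < p⁻¹ := inv_pos.2 hp0
      norm_num at hz
      exact hp0.ne hz
    have hkey := noise_sq_mul_le_of_mem_ermSet ht j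
      (fun i hi => eq_zero_of_mem_singleSpike hspike hi) hz0
    rw [hz] at hkey
    simp only at hlow hup hcorr
    rw [← Finset.add_sum_erase _ _ (Finset.mem_univ j), real_inner_self_eq_norm_sq] at hkey
    set a := ‖(S j).1‖ ^ 2
    set T := ∑ i ∈ Finset.univ.erase j, (inner ℝ (S i).1 (S j).1) ^ 2
    have ha : 0 ≤ a := sq_nonneg _
    have hT : 0 ≤ T := Finset.sum_nonneg fun _ _ => sq_nonneg _
    -- Here `M ≤ N` enters: `a² ≤ 64 M² ≤ 64 NM`, and `T ≤ 8 NM`.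
    have hQ : a ^ 2 + T ≤ 72 * N * M := by nlinarith
    have h1 : p⁻¹ * ((M : ℝ) / 128) ^ 3 ≤ ‖t - tstar‖ ^ 2 * (72 * N * M) ^ 2 :=
      (mul_le_mul_of_nonneg_left (pow_le_pow_left₀ (by positivity) hlow 3) (by positivity)).trans
        (hkey.trans (mul_le_mul_of_nonneg_left (pow_le_pow_left₀ (by positivity) hQ 2)
          (by positivity)))
    have hp' : p⁻¹ = 2 * x * N := by rw [hp, one_div, inv_inv]
    rw [hp'] at h1
    have h2 : (1 / (128 ^ 3 * 72 ^ 2) * x * (M : ℝ) / N) * (72 * N * M) ^ 2 ≤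
        2 * x * N * ((M : ℝ) / 128) ^ 3 := by
      have : (1 / (128 ^ 3 * 72 ^ 2) * x * (M : ℝ) / N) * (72 * N * M) ^ 2 =
          x * N * ((M : ℝ) / 128) ^ 3 := by
        field_simp
      rw [this]
      have : 0 ≤ x * N * ((M : ℝ) / 128) ^ 3 := by positivity
      linarith
    exact le_of_mul_le_mul_right (h2.trans h1) (by positivity)

end GaussianLinearModel

theorem mainTheorem4 :
    (∃ c₀ c₁ c₂ : ℝ, 0 < c₀ ∧ 0 < c₁ ∧ 0 < c₂ ∧
      ∀ (M N : ℕ) (x : ℝ), 1 ≤ x → c₀ * (M : ℝ) ≤ (N : ℝ) →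
        ∃ ν : Measure ℝ, GaussianLinearModel.IsStandardizedNoise ν ∧
          ∀ tstar : EuclideanSpace ℝ (Fin M),
            (∀ t : EuclideanSpace ℝ (Fin M),
              Integrable (GaussianLinearModel.loss t) (GaussianLinearModel.modelLaw tstar ν) ∧
              ‖t - tstar‖ ^ 2 = GaussianLinearModel.risk tstar ν t
                - GaussianLinearModel.risk tstar ν tstar) ∧
            c₁ / x ≤ (GaussianLinearModel.sampleLaw N tstar ν).real
              {S | (GaussianLinearModel.ermSet S).Nonempty ∧
                ∀ t ∈ GaussianLinearModel.ermSet S,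
                  c₂ * x * (M : ℝ) / (N : ℝ) ≤ ‖t - tstar‖ ^ 2}) ∧
    (∀ (M : ℕ), 1 ≤ M → ∀ (tstar : EuclideanSpace ℝ (Fin M)) (C K b : ℝ) (ε : ℕ → ℝ),
      0 < C → 0 < K → 0 < b → Tendsto ε atTop (𝓝 0) →
        ¬ ∀ x : ℝ, 1 ≤ x → ∀ᶠ N : ℕ in atTop,
          ∀ ν : Measure ℝ, GaussianLinearModel.IsStandardizedNoise ν →
            1 - ε N - K * Real.exp (-(b * x)) ≤
              (GaussianLinearModel.sampleLaw N tstar ν).real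
                {S | ∃ t ∈ GaussianLinearModel.ermSet S,
                  ‖t - tstar‖ ^ 2 ≤ C * x * (M : ℝ) / (N : ℝ)}) := by
  refine ⟨⟨1, 1 / 8, 1 / (128 ^ 3 * 72 ^ 2), by norm_num, by norm_num, by norm_num, ?_⟩, ?_⟩
  · intro M N x hx hMN
    have hx0 : 0 < x := by linarith
    rw [one_mul, Nat.cast_le] at hMN
    rcases Nat.eq_zero_or_pos M with rfl | hM
    · have hν := GaussianLinearModel.isStandardizedNoise_sparseNoise one_pos le_rfl
      have := hν.isProbabilityMeasure
      refine ⟨_, hν, fun tstar => ⟨fun t => ?_, ?_⟩⟩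
      · obtain ⟨h1, h2⟩ := GaussianLinearModel.integrable_loss_and_risk_eq hν tstar t
        refine ⟨h1, ?_⟩
        rw [h2, (GaussianLinearModel.integrable_loss_and_risk_eq hν tstar tstar).2]
        simp
      · have huniv : 1 / 8 / x ≤ (GaussianLinearModel.sampleLaw N tstar
            (GaussianLinearModel.sparseNoise 1)).real Set.univ := by
          rw [probReal_univ]
          exact (div_le_one hx0).2 (by linarith)
        exact huniv.trans (measureReal_mono fun S _ =>
          ⟨GaussianLinearModel.ermSet_nonempty S, fun t _ => by simp⟩)
    · have hN : 1 ≤ N := le_trans hM hMN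
      have hν := GaussianLinearModel.isStandardizedNoise_sparseNoise_of_one_le hN hx
      have := hν.isProbabilityMeasure
      refine ⟨_, hν, fun tstar => ⟨fun t => ?_, ?_⟩⟩
      · obtain ⟨h1, h2⟩ := GaussianLinearModel.integrable_loss_and_risk_eq hν tstar t
        refine ⟨h1, ?_⟩
        rw [h2, (GaussianLinearModel.integrable_loss_and_risk_eq hν tstar tstar).2]
        simp
      · obtain ⟨G, -, hG, hsub⟩ :=
          GaussianLinearModel.exists_measurableSet_subset_error_ge hM hMN hx tstar
        exact hG.trans (measureReal_mono fun S hS =>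
          ⟨GaussianLinearModel.ermSet_nonempty S, hsub S hS⟩)
  · intro M hM tstar C K b ε hC hK hb hε hcon
    set c : ℝ := 1 / (128 ^ 3 * 72 ^ 2) with hc
    have hc0 : 0 < c := by rw [hc]; norm_num
    -- Chosen so that `c D = C + c > C`: on the bad event at level `D x`, every minimizer has error
    -- above `C x M / N`.
    set D : ℝ := C / c + 1 with hD
    have hD1 : 1 ≤ D := by rw [hD]; linarith [div_pos hC hc0]
    have hbound : ∀ x : ℝ, 1 ≤ x → 1 / 8 / (D * x) ≤ K * Real.exp (-(b * x)) := by
      intro x hx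
      have hDx : 1 ≤ D * x := one_le_mul_of_one_le_of_one_le hD1 hx
      have hlim : Tendsto (fun N => ε N + K * Real.exp (-(b * x))) atTop
          (𝓝 (0 + K * Real.exp (-(b * x)))) := hε.add_const _
      rw [zero_add] at hlim
      -- Letting `N → ∞` at fixed `x` removes `ε N`; the noise law may vary with `N`.
      refine ge_of_tendsto hlim ?_
      filter_upwards [hcon x hx, eventually_ge_atTop M] with N hN hMN
      have hν := GaussianLinearModel.isStandardizedNoise_sparseNoise_of_one_le
        (le_trans hM hMN) hDx
      have := hν.isProbabilityMeasure
      obtain ⟨G, hGm, hG, hsub⟩ :=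
        GaussianLinearModel.exists_measurableSet_subset_error_ge hM hMN hDx tstar
      have h1 := hN _ hν
      have hcompl : {S | ∃ t ∈ GaussianLinearModel.ermSet S,
          ‖t - tstar‖ ^ 2 ≤ C * x * (M : ℝ) / (N : ℝ)} ⊆ Gᶜ := by
        rintro S ⟨t, ht, hle⟩ hS
        have h3 := (hsub S hS t ht).trans hle
        have hM' : (0 : ℝ) < M := by exact_mod_cast hM
        have hN' : (0 : ℝ) < N := by exact_mod_cast le_trans hM hMN
        rw [div_le_div_iff_of_pos_right hN', mul_le_mul_iff_left₀ hM', ← mul_assoc,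
          mul_le_mul_iff_left₀ (by linarith : (0 : ℝ) < x), ← hc, hD, mul_add,
          mul_div_cancel₀ _ hc0.ne'] at h3
        linarith
      have h2 := h1.trans (measureReal_mono hcompl)
      rw [probReal_compl_eq_one_sub hGm] at h2
      linarith
    -- Multiplied by `D x`, the bound keeps 1/8 below a quantity tending to zero as `x → ∞`.
    have hlim : Tendsto (fun x : ℝ => K * (D * (x * Real.exp (-(b * x))))) atTop
        (𝓝 (K * (D * 0))) := by
      refine Tendsto.const_mul _ (Tendsto.const_mul _ ?_)
      simpa using tendsto_rpow_mul_exp_neg_mul_atTop_nhds_zero 1 b hb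
    have hge : (1 : ℝ) / 8 ≤ K * (D * 0) := by
      refine ge_of_tendsto hlim ?_
      filter_upwards [eventually_ge_atTop 1] with x hx
      have h := hbound x hx
      rw [div_le_iff₀ (by positivity)] at h
      linarith
    norm_num at hge
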